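/- A pospace is a topological space $X$ with a partial order $\leq$ (no compatibility is required); a dimap is a continuous order-preserving map. Let $(C,\leq)$ be a pospace. A $(C,\leq)$-pospace is a triple $(X,\leq,\xi)$ with $(X,\leq)$ a pospace and $\xi:(C,\leq)\to(X,\leq)$ a dimap; a $(C,\leq)$-dimap $(X,\leq,\xi)\to(Y,\leq,\theta)$ is a dimap $f$ with $f\circ\xi=\theta$. Let $I=[0,1]$ with its usual topology and let $\Delta$ be the equality order. Products of pospaces carry the product topology and the componentwise order. Two $(C,\leq)$-dimaps $f,g:(X,\leq,\xi)\to(Y,\leq,\theta)$ are dihomotopic relative to $(C,\leq)$ if there is a dimap $H:(X,\leq)\times(I,\Delta)\to(Y,\leq)$ with $H(x,0)=f(x)$, $H(x,1)=g(x)$ for $x\in X$ and $H(\xi(c),t)=\theta(c)$ for $c\in C$, $t\in I$. A $(C,\leq)$-dimap $f:X\to Y$ is a dihomotopy equivalence relative to $(C,\leq)$ if there is a $(C,\leq)$-dimap $g:Y\to X$ such that $f\circ g$ and $g\circ f$ are dihomotopic relative to $(C,\leq)$ to the identities. The cylinder $X\Box_C I$ of $(X,\leq,\xi)$ is the quotient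 space of $X\times I$ by the relation $(\xi(c),s)\sim(\xi(c),t)$ $(c\in C,\ s,t\in I)$, with the partial order $[x,s]\leq[x',s']$ if and only if ($x\leq x'$ and $s=s'$) or $x\leq\xi(c)\leq x'$ for some $c\in C$, and with the structure map $c\mapsto[\xi(c),0]$. A $(C,\leq)$-difibration is a $(C,\leq)$-dimap having the right lifting property with respect to all the $(C,\leq)$-dimaps $i_0:X\to X\Box_C I$, $x\mapsto[x,0]$. A $(C,\leq)$-dicofibration is a $(C,\leq)$-dimap having the left lifting property with respect to all $(C,\leq)$-difibrations that are dihomotopy equivalences relative to $(C,\leq)$. A category with two classes of morphisms, cofibrations and weak equivalences (a trivial cofibration being a morphism in both classes), is a cofibration category if it has an initial object $\emptyset$ and the following hold. - (C1) Isomorphisms are trivial cofibrations; composites of cofibrations are cofibrations; if two of $f$, $g$, $g\circ f$ are weak equivalences, so is the third. - (C2) The pushout of two morphisms one of which is a cofibration exists; cofibrations are stable under cobase change; the cobase extension of a weak equivalence along a cofibration is a weak equivalence. - (C3) Every morphism $f$ factors as $f=r\circ i$ with $i$ a cofibration and $r$ a weak equivalence. - (C4) For every object $X$ there is a trivial cofibration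 $X\to Y$ with $Y$ fibrant, i.e. such that every trivial cofibration $Y\to Z$ admits a retraction. An object $X$ is $\emptyset$-cofibrant if $\emptyset\to X$ is a cofibration. Two morphisms $f,g:X\to Y$ from an $\emptyset$-cofibrant to a fibrant object are homotopic in the cofibration category if, for some factorization $X\coprod X\xrightarrow{i}IX\xrightarrow{r}X$ of $(\mathrm{id}_X,\mathrm{id}_X)$ into a cofibration $i$ followed by a weak equivalence $r$, there is a morphism $H:IX\to Y$ with $H\circ i=(f,g)$. **Theorem.** Let $(C,\leq)$ be a pospace. The category of $(C,\leq)$-pospaces and $(C,\leq)$-dimaps, with the $(C,\leq)$-dicofibrations as cofibrations and the dihomotopy equivalences relative to $(C,\leq)$ as weak equivalences, is a cofibration category. All objects are fibrant and $\emptyset$-cofibrant. Two $(C,\leq)$-dimaps with the same source and target are homotopic in this cofibration category if and only if they are dihomotopic relative to $(C,\leq)$. -/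

import Mathlib

open CategoryTheory CategoryTheory.Limits

universe u v

/-- A pospace: a topological space with a partial order (no closedness condition on the order). -/
structure PoTop : Type (u + 1) where
  /-- The bundled pospace on a type with a topology and a partial order. -/
  of ::
  /-- The underlying set. -/
  carrier : Type u
  [topology : TopologicalSpace carrier]
  [order : PartialOrder carrier]

attribute [instance] PoTop.topology PoTop.order

namespace PoTop

instance : CoeSort PoTop.{u} (Type u) := ⟨PoTop.carrier⟩

/-- Dimaps: continuous order preserving maps. -/
@[ext]
structure Hom (X Y : PoTop.{u}) where
  /-- The underlying continuous monotone map. -/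
  hom' : X →Co Y

instance : Category PoTop.{u} where
  Hom X Y := Hom X Y
  id X := ⟨ContinuousOrderHom.id X⟩
  comp f g := ⟨g.hom'.comp f.hom'⟩

instance : ConcreteCategory PoTop.{u} (fun X Y => X →Co Y) where
  hom f := f.hom'
  ofHom f := ⟨f⟩

/-- The dimap with a given underlying continuous monotone map. -/
abbrev ofHom {X Y : PoTop.{u}} (f : X →Co Y) : X ⟶ Y :=
  ConcreteCategory.ofHom (C := PoTop.{u}) f

/-- The pospace `(S, Δ)`: a space `S` whose order is equality. -/
def discrete (S : Type u) [TopologicalSpace S] : PoTop.{u} :=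
  letI : PartialOrder S :=
    { le := fun a b => a = b
      le_refl := fun _ => rfl
      le_trans := fun _ _ _ h h' => h.trans h'
      le_antisymm := fun _ _ h _ => h }
  PoTop.of S

/-- The pospace `(I, Δ)`: the unit interval with the usual topology and with equality as order. -/
def interval : PoTop.{0} := discrete unitInterval

/-- The point `0` of `(I, Δ)`. -/
def i0 : interval := (0 : unitInterval)

/-- The point `1` of `(I, Δ)`. -/
def i1 : interval := (1 : unitInterval)

/-- The product pospace: product topology and componentwise order. -/
def prod (X : PoTop.{u}) (Y : PoTop.{v}) : PoTop.{max u v} := PoTop.of (X × Y)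

end PoTop

/-- `(C,≤)`-pospaces: pospaces `X` with a dimap `ξ : C ⟶ X` (for `X : UnderPo C` the pospace is
`X.right` and `ξ` is `X.hom`); the morphisms are the dimaps compatible with the maps from `C`. -/
abbrev UnderPo (C : PoTop.{u}) := Under C

namespace UnderPo

variable {C : PoTop.{u}}

section Cylinder

variable (X : UnderPo C)

/-- The relation on `X × I` which identifies `(ξ c, s)` with `(ξ c, t)`. -/
def cylSetoid : Setoid (X.right × PoTop.interval) where
  r p q := p = q ∨ ∃ c : C, p.1 = X.hom c ∧ q.1 = X.hom c
  iseqv :=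
    { refl := fun _ => Or.inl rfl
      symm := by
        rintro p q (h | ⟨c, h, h'⟩)
        · exact Or.inl h.symm
        · exact Or.inr ⟨c, h', h⟩
      trans := by
        rintro p q r (rfl | ⟨c, h, h'⟩) (rfl | ⟨d, k, k'⟩)
        · exact Or.inl rfl
        · exact Or.inr ⟨d, k, k'⟩
        · exact Or.inr ⟨c, h, h'⟩
        · exact Or.inr ⟨c, h, k'.trans (k.symm.trans h')⟩ }

/-- The underlying set of the cylinder. -/
def CylSpace : Type u := Quotient (cylSetoid X)

/-- The class `[x,t]` of a point of `X × I` in the cylinder. -/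
def cylMk (p : X.right × PoTop.interval) : CylSpace X := Quotient.mk (cylSetoid X) p

/-- The cylinder carries the quotient topology. -/
instance cylTopology : TopologicalSpace (CylSpace X) :=
  TopologicalSpace.coinduced (cylMk X) inferInstance

/-- The order relation of the cylinder on representatives: `(x,s) ≤ (x',s')` in
`(X,≤) × (I,Δ)`, or `x ≤ ξ c ≤ x'` for some `c`. -/
def cylRel (p q : X.right × PoTop.interval) : Prop :=
  p ≤ q ∨ ∃ c : C, p.1 ≤ X.hom c ∧ X.hom c ≤ q.1

variable {X} in
lemma cylRel_of_equiv {p q : X.right × PoTop.interval} (h : (cylSetoid X).r p q) :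
    cylRel X p q := by
  rcases h with rfl | ⟨c, h, h'⟩
  · exact Or.inl le_rfl
  · exact Or.inr ⟨c, h.le, h'.ge⟩

variable {X} in
lemma cylRel_trans {p q r : X.right × PoTop.interval} (h : cylRel X p q) (h' : cylRel X q r) :
    cylRel X p r := by
  rcases h with h | ⟨c, h1, h2⟩ <;> rcases h' with h' | ⟨d, k1, k2⟩
  · exact Or.inl (h.trans h')
  · exact Or.inr ⟨d, h.1.trans k1, k2⟩
  · exact Or.inr ⟨c, h1, h2.trans h'.1⟩
  · exact Or.inr ⟨c, h1, h2.trans (k1.trans k2)⟩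

variable {X} in
lemma equiv_of_cylRel {p q : X.right × PoTop.interval} (h : cylRel X p q) (h' : cylRel X q p) :
    (cylSetoid X).r p q := by
  rcases h with h | ⟨c, h1, h2⟩ <;> rcases h' with h' | ⟨d, k1, k2⟩
  · exact Or.inl (le_antisymm h h')
  · exact Or.inr ⟨d, le_antisymm (h.1.trans k1) k2, le_antisymm k1 (k2.trans h.1)⟩
  · exact Or.inr ⟨c, le_antisymm h1 (h2.trans h'.1), le_antisymm (h'.1.trans h1) h2⟩
  · exact Or.inr ⟨c, le_antisymm h1 (h2.trans (k1.trans k2)),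
      le_antisymm (k1.trans (k2.trans h1)) h2⟩

instance cylOrder : PartialOrder (CylSpace X) where
  le := Quotient.lift₂ (cylRel X) (by
    intro a b a' b' h h'
    exact propext
      ⟨fun k => cylRel_trans (cylRel_of_equiv ((cylSetoid X).symm h))
          (cylRel_trans k (cylRel_of_equiv h')),
        fun k => cylRel_trans (cylRel_of_equiv h)
          (cylRel_trans k (cylRel_of_equiv ((cylSetoid X).symm h')))⟩)
  le_refl := by
    rintro ⟨p⟩
    exact Or.inl le_rfl
  le_trans := by
    rintro ⟨p⟩ ⟨q⟩ ⟨r⟩ h h'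
    exact cylRel_trans h h'
  le_antisymm := by
    rintro ⟨p⟩ ⟨q⟩ h h'
    exact Quotient.sound (equiv_of_cylRel h h')

/-- The dimap `x ↦ [x,t]` from a pospace to its cylinder. -/
def cylSlice (t : PoTop.interval) : X.right ⟶ PoTop.of (CylSpace X) :=
  PoTop.ofHom
    { toFun := fun x => cylMk X (x, t)
      monotone' := fun _ _ h => Or.inl ⟨h, le_rfl⟩
      continuous_toFun := continuous_coinduced_rng.comp (by fun_prop) }

/-- The cylinder `X □_C I` of a `(C,≤)`-pospace: the quotient of `X × I` by `(ξ c, s) ~ (ξ c, t)`,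
with structure map `c ↦ [ξ c, 0]`, which is `[ξ c, t]` for every `t`. -/
def cyl : UnderPo C := Under.mk (X.hom ≫ cylSlice X PoTop.i0)

/-- The morphism `i_0 : X ⟶ X □_C I`, `x ↦ [x,0]`. -/
def cylIn0 : X ⟶ cyl X := Under.homMk (cylSlice X PoTop.i0) rfl

end Cylinder

/-- `f` and `g` are dihomotopic relative to `(C,≤)`: there is a dimap
`H : (X,≤) × (I,Δ) ⟶ (Y,≤)` from `f` to `g` which is stationary on the image of `C`. -/
def Dihomotopic {X Y : UnderPo C} (f g : X ⟶ Y) : Prop :=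
  ∃ H : PoTop.prod X.right PoTop.interval ⟶ Y.right,
    (∀ x : X.right, H (x, PoTop.i0) = f.right x) ∧
    (∀ x : X.right, H (x, PoTop.i1) = g.right x) ∧
    ∀ (c : C) (t : PoTop.interval), H (X.hom c, t) = Y.hom c

variable (C)

/-- The dihomotopy equivalences relative to `(C,≤)`. -/
def dihomotopyEquivalences : MorphismProperty (UnderPo C) := fun X Y f =>
  ∃ g : Y ⟶ X, Dihomotopic (g ≫ f) (𝟙 Y) ∧ Dihomotopic (f ≫ g) (𝟙 X)

/-- The `(C,≤)`-difibrations: right lifting property with respect to all the morphisms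
`i_0 : X ⟶ X □_C I`. -/
def difibrations : MorphismProperty (UnderPo C) := fun _ _ p =>
  ∀ X : UnderPo C, HasLiftingProperty (cylIn0 X) p

/-- The `(C,≤)`-dicofibrations: left lifting property with respect to the morphisms that are both
difibrations and relative dihomotopy equivalences. -/
def dicofibrations : MorphismProperty (UnderPo C) :=
  (difibrations C ⊓ dihomotopyEquivalences C).llp

end UnderPo

namespace CofCat

variable {𝒞 : Type u} [Category.{v} 𝒞] (W Cof : MorphismProperty 𝒞)

/-- `Y` is fibrant: every trivial cofibration out of `Y` admits a retraction. -/
def Fibrant (Y : 𝒞) : Prop :=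
  ∀ ⦃Z : 𝒞⦄ (i : Y ⟶ Z), Cof i → W i → ∃ r : Z ⟶ Y, i ≫ r = 𝟙 Y

/-- `X` is `∅`-cofibrant: the morphism from the initial object to `X` is a cofibration. -/
def EmptyCofibrant (X : 𝒞) : Prop :=
  ∃ (E : 𝒞) (hE : IsInitial E), Cof (hE.to X)

/-- A category with weak equivalences `W` and cofibrations `Cof` is a cofibration category
(in the sense of Baues, with an initial object). -/
structure IsCofibrationCategory : Prop where
  hasInitial : HasInitial 𝒞
  cof_of_isIso : ∀ ⦃X Y : 𝒞⦄ (f : X ⟶ Y), IsIso f → Cof f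
  weq_of_isIso : ∀ ⦃X Y : 𝒞⦄ (f : X ⟶ Y), IsIso f → W f
  cof_comp : ∀ ⦃X Y Z : 𝒞⦄ (f : X ⟶ Y) (g : Y ⟶ Z), Cof f → Cof g → Cof (f ≫ g)
  weq_comp : ∀ ⦃X Y Z : 𝒞⦄ (f : X ⟶ Y) (g : Y ⟶ Z), W f → W g → W (f ≫ g)
  weq_of_postcomp : ∀ ⦃X Y Z : 𝒞⦄ (f : X ⟶ Y) (g : Y ⟶ Z), W g → W (f ≫ g) → W f
  weq_of_precomp : ∀ ⦃X Y Z : 𝒞⦄ (f : X ⟶ Y) (g : Y ⟶ Z), W f → W (f ≫ g) → W g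
  hasPushout : ∀ ⦃A X Y : 𝒞⦄ (i : A ⟶ X) (f : A ⟶ Y), Cof i → HasPushout i f
  cof_cobaseChange : ∀ ⦃A X Y Z : 𝒞⦄ (i : A ⟶ X) (f : A ⟶ Y) (f' : X ⟶ Z) (i' : Y ⟶ Z),
    IsPushout i f f' i' → Cof i → Cof i'
  weq_cobaseChange : ∀ ⦃A X Y Z : 𝒞⦄ (i : A ⟶ X) (f : A ⟶ Y) (f' : X ⟶ Z) (i' : Y ⟶ Z),
    IsPushout i f f' i' → Cof i → W f → W f'
  factorization : ∀ ⦃X Y : 𝒞⦄ (f : X ⟶ Y), ∃ (Z : 𝒞) (i : X ⟶ Z) (r : Z ⟶ Y),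
    Cof i ∧ W r ∧ i ≫ r = f
  fibrantModel : ∀ X : 𝒞, ∃ (Y : 𝒞) (i : X ⟶ Y), Cof i ∧ W i ∧ Fibrant W Cof Y

/-- The homotopy relation of a cofibration category (for morphisms from an `∅`-cofibrant object to
a fibrant object): for some factorization of the fold map `X ⨿ X ⟶ X` into a cofibration `i`
followed by a weak equivalence `r`, the morphism `(f,g) : X ⨿ X ⟶ Y` extends along `i`. -/
def Homotopic {X Y : 𝒞} (f g : X ⟶ Y) : Prop :=
  ∃ (_ : HasBinaryCoproduct X X) (IX : 𝒞) (i : X ⨿ X ⟶ IX) (r : IX ⟶ X) (H : IX ⟶ Y),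
    Cof i ∧ W r ∧ i ≫ r = coprod.desc (𝟙 X) (𝟙 X) ∧ i ≫ H = coprod.desc f g

end CofCat

/-!
# The cofibration category of `(C,≤)`-pospaces

The proof works with path objects instead of cylinders: the cylinder is left adjoint to the functor
that sends `Y` to the pospace `pathObj Y` of all continuous paths in `Y` with the pointwise order,
so that a relative dihomotopy is a morphism `X ⟶ pathObj Y`, and a difibration is a morphism with a
path lifting function that is itself a morphism under `C`. The argument is then the one by which the Hurewicz
fibrations and the homotopy equivalences of spaces give a cofibration category.

* Being dihomotopic is a congruence, and the weak equivalences are the morphisms that become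
  invertible in the quotient category. This gives the two out of three property.
* Difibrations allow a family of paths over a reparametrized path to be deformed so that it lies
  over another reparametrization (`difibrations.exists_reparam`). It follows that a trivial
  difibration `p` has a section `s` with `s p` homotopic to the identity over the base (Dold's
  theorem, `exists_section_of_trivial`), and that homotopies lift along `p` with both ends prescribed
  (`exists_lift_of_trivial`). So objects are cofibrant, and the ends of a cylinder, as well as the
  free end of a mapping cylinder, are included by dicofibrations. This provides the factorizations
  and the homotopy relation.
* Evaluation of paths at `0` is a trivial difibration. Hence dicofibrations have the homotopy
  extension property, and every object is fibrant.
* A weak equivalence `f` factors through its mapping path object as the inclusion of a strong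
  deformation retract followed by a trivial difibration, which is shrinkable by Dold's theorem.
  Strong deformation retracts are stable under every cobase change, and the cobase change of a
  shrinkable map along a morphism with the homotopy extension property is a weak equivalence. Hence
  the same holds for `f` (`dihomotopyEquivalences_cobaseChange`).
* Pushouts are taken on the disjoint union, with the preorder of those inequalities that hold in
  every poset receiving compatible monotone maps; the topology is the quotient topology, since the
  order and the topology of a pospace need not be compatible.
-/

namespace UnderPo

open unitInterval

variable {C : PoTop.{u}}

/-! ### Path objects and homotopies -/

lemma right_hom_apply {X Y : UnderPo C} (f : X ⟶ Y) (c : C) :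
    f.right (X.hom c) = Y.hom c := by
  rw [← Under.w f]; rfl

@[fun_prop]
lemma continuous_right {X Y : UnderPo C} (f : X ⟶ Y) : Continuous fun x => f.right x :=
  map_continuous (ConcreteCategory.hom f.right)

lemma monotone_right {X Y : UnderPo C} (f : X ⟶ Y) : Monotone fun x => f.right x :=
  (ConcreteCategory.hom f.right).monotone'

lemma hom_ext_apply {X Y : UnderPo C} {f g : X ⟶ Y} (h : ∀ x : X.right, f.right x = g.right x) :
    f = g := by
  ext x
  exact h x

/-- The morphism of `(C,≤)`-pospaces given by a continuous monotone map under `C`. -/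
def mkHom {X Y : UnderPo C} (F : X.right → Y.right) (hF : Continuous F) (hm : Monotone F)
    (hC : ∀ c : C, F (X.hom c) = Y.hom c) : X ⟶ Y :=
  Under.homMk (PoTop.ofHom { toFun := F, monotone' := hm, continuous_toFun := hF }) (by
    ext c
    exact hC c)

/-- The path object of a `(C,≤)`-pospace `Y`: all continuous paths in `Y` (a path need not be
monotone, because `I` carries the equality order), with the compact-open topology, the pointwise
order, and the constant paths as structure map. It is right adjoint to the cylinder. -/
def pathObj (Y : UnderPo C) : UnderPo C :=
  Under.mk (Y := PoTop.of C(I, Y.right)) (PoTop.ofHom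
    { toFun := fun c => ContinuousMap.const I (Y.hom c)
      monotone' := fun _ _ h _ => (ConcreteCategory.hom Y.hom).monotone' h
      continuous_toFun :=
        ContinuousMap.continuous_const'.comp (map_continuous (ConcreteCategory.hom Y.hom)) })

/-- The point `γ t` of a path `γ`. -/
def pt {Y : UnderPo C} (γ : (pathObj Y).right) (t : I) : Y.right :=
  DFunLike.coe (F := C(I, Y.right)) γ t

lemma pt_ext {Y : UnderPo C} {γ δ : (pathObj Y).right} (h : ∀ t, pt γ t = pt δ t) : γ = δ :=
  ContinuousMap.ext (f := γ) (g := δ) h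

@[simp]
lemma pt_hom {Y : UnderPo C} (c : C) (t : I) : pt ((pathObj Y).hom c) t = Y.hom c := rfl

@[fun_prop]
lemma continuous_pt {Y : UnderPo C} {S : Type*} [TopologicalSpace S] {γ : S → (pathObj Y).right}
    {t : S → I} (hγ : Continuous γ) (ht : Continuous t) : Continuous fun s => pt (γ s) (t s) :=
  Continuous.eval (F := C(I, Y.right)) hγ ht

lemma pt_mono {Y : UnderPo C} {γ δ : (pathObj Y).right} (h : γ ≤ δ) (t : I) : pt γ t ≤ pt δ t :=
  h t

/-- The path given by a continuous function on the unit interval. -/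
def mkPt {Y : UnderPo C} (γ : I → Y.right) (h : Continuous γ) : (pathObj Y).right :=
  (⟨γ, h⟩ : C(I, Y.right))

@[simp]
lemma pt_mkPt {Y : UnderPo C} (γ : I → Y.right) (h : Continuous γ) (t : I) :
    pt (mkPt γ h) t = γ t := rfl

lemma continuous_mkPt {Y : UnderPo C} {S : Type*} [TopologicalSpace S] (γ : S → I → Y.right)
    (hγ : Continuous fun p : S × I => γ p.1 p.2) :
    Continuous fun s => mkPt (γ s) (hγ.comp (Continuous.prodMk_right s)) :=
  ContinuousMap.continuous_of_continuous_uncurry (fun s => (mkPt (γ s) _ : C(I, Y.right))) hγ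

/-- The morphism to a path object which corresponds to a continuous family of paths. -/
def toPath {X Y : UnderPo C} (F : X.right → I → Y.right)
    (hF : Continuous fun p : X.right × I => F p.1 p.2) (hm : ∀ t, Monotone fun x => F x t)
    (hC : ∀ (c : C) t, F (X.hom c) t = Y.hom c) : X ⟶ pathObj Y :=
  mkHom (fun x => mkPt (F x) (hF.comp (Continuous.prodMk_right x))) (continuous_mkPt F hF)
    (fun _ _ h t => hm t h) (fun c => pt_ext (hC c))

@[simp]
lemma pt_toPath {X Y : UnderPo C} (F : X.right → I → Y.right)
    (hF : Continuous fun p : X.right × I => F p.1 p.2) (hm : ∀ t, Monotone fun x => F x t)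
    (hC : ∀ (c : C) t, F (X.hom c) t = Y.hom c) (x : X.right) (t : I) :
    pt ((toPath F hF hm hC).right x) t = F x t := rfl

lemma path_hom_ext {X Y : UnderPo C} {h k : X ⟶ pathObj Y}
    (w : ∀ x t, pt (h.right x) t = pt (k.right x) t) : h = k :=
  hom_ext_apply fun x => pt_ext (w x)

lemma pt_right_mono {X Y : UnderPo C} (h : X ⟶ pathObj Y) (t : I) :
    Monotone fun x => pt (h.right x) t := fun _ _ w => pt_mono (monotone_right h w) t

lemma pt_right_hom {X Y : UnderPo C} (h : X ⟶ pathObj Y) (c : C) (t : I) :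
    pt (h.right (X.hom c)) t = Y.hom c := by
  rw [right_hom_apply, pt_hom]

/-- Evaluation of paths at the time `t`. -/
def evalAt (Y : UnderPo C) (t : I) : pathObj Y ⟶ Y :=
  mkHom (fun γ => pt γ t) (by fun_prop) (fun _ _ h => pt_mono h t) (fun _ => rfl)

@[simp]
lemma evalAt_apply (Y : UnderPo C) (t : I) (γ : (pathObj Y).right) :
    (evalAt Y t).right γ = pt γ t := rfl

/-- The constant paths. -/
def constPath (Y : UnderPo C) : Y ⟶ pathObj Y :=
  toPath (fun y _ => y) (by fun_prop) (fun _ _ _ h => h) (fun _ _ => rfl)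

@[simp]
lemma pt_constPath (Y : UnderPo C) (y : Y.right) (t : I) : pt ((constPath Y).right y) t = y := rfl

/-- The action of a morphism on paths. -/
def pathMap {X Y : UnderPo C} (f : X ⟶ Y) : pathObj X ⟶ pathObj Y :=
  toPath (fun γ t => f.right (pt γ t)) (by fun_prop)
    (fun t _ _ h => monotone_right f (pt_mono h t)) (fun c t => by simp [right_hom_apply])

@[simp]
lemma pt_pathMap {X Y : UnderPo C} (f : X ⟶ Y) (γ : (pathObj X).right) (t : I) :
    pt ((pathMap f).right γ) t = f.right (pt γ t) := rfl

/-- A homotopy from `f` to `g` with the parameter moved into the target is a morphism to the path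
object which restricts to `f` and to `g` at the ends. -/
structure IsHomotopy {X Y : UnderPo C} (h : X ⟶ pathObj Y) (f g : X ⟶ Y) : Prop where
  zero : h ≫ evalAt Y 0 = f
  one : h ≫ evalAt Y 1 = g

namespace IsHomotopy

variable {X Y Z : UnderPo C} {f g : X ⟶ Y} {h : X ⟶ pathObj Y}

lemma mk' (h0 : ∀ x, pt (h.right x) 0 = f.right x) (h1 : ∀ x, pt (h.right x) 1 = g.right x) :
    IsHomotopy h f g := ⟨hom_ext_apply (by simpa using h0), hom_ext_apply (by simpa using h1)⟩

lemma pt_zero (w : IsHomotopy h f g) (x : X.right) : pt (h.right x) 0 = f.right x := by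
  simp [← w.zero]

lemma pt_one (w : IsHomotopy h f g) (x : X.right) : pt (h.right x) 1 = g.right x := by
  simp [← w.one]

lemma precomp (w : IsHomotopy h f g) (k : Z ⟶ X) : IsHomotopy (k ≫ h) (k ≫ f) (k ≫ g) :=
  mk' (by simp [w.pt_zero]) (by simp [w.pt_one])

lemma postcomp (w : IsHomotopy h f g) (k : Y ⟶ Z) :
    IsHomotopy (h ≫ pathMap k) (f ≫ k) (g ≫ k) :=
  mk' (by simp [w.pt_zero]) (by simp [w.pt_one])

lemma const (f : X ⟶ Y) : IsHomotopy (f ≫ constPath Y) f f :=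
  mk' (by simp) (by simp)

end IsHomotopy

/-- The homotopy `h` run backwards. -/
def symmPath {X Y : UnderPo C} (h : X ⟶ pathObj Y) : X ⟶ pathObj Y :=
  toPath (fun x t => pt (h.right x) (σ t)) (by fun_prop) (fun t => pt_right_mono h (σ t))
    (fun c t => pt_right_hom h c (σ t))

@[simp]
lemma pt_symmPath {X Y : UnderPo C} (h : X ⟶ pathObj Y) (x : X.right) (t : I) :
    pt ((symmPath h).right x) t = pt (h.right x) (σ t) := rfl

lemma IsHomotopy.symm {X Y : UnderPo C} {f g : X ⟶ Y} {h : X ⟶ pathObj Y}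
    (w : IsHomotopy h f g) : IsHomotopy (symmPath h) g f :=
  .mk' (by simp [w.pt_one]) (by simp [w.pt_zero])

/-- A real number, moved to the nearest point of the unit interval. -/
noncomputable abbrev clamp (r : ℝ) : I := Set.projIcc 0 1 zero_le_one r

@[fun_prop]
lemma continuous_clamp {S : Type*} [TopologicalSpace S] {f : S → ℝ} (hf : Continuous f) :
    Continuous fun s => clamp (f s) := continuous_projIcc.comp hf

lemma clamp_of_le_zero {r : ℝ} (h : r ≤ 0) : clamp r = 0 := Set.projIcc_of_le_left _ h

lemma clamp_of_one_le {r : ℝ} (h : 1 ≤ r) : clamp r = 1 := Set.projIcc_of_right_le _ h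

@[simp]
lemma clamp_coe (t : I) : clamp (t : ℝ) = t := Set.projIcc_val _ t

lemma coe_clamp (r : ℝ) : (clamp r : ℝ) = max 0 (min 1 r) := rfl

/-- The concatenation of the homotopies `h` and `k`. -/
noncomputable def transPath {X Y : UnderPo C} (h k : X ⟶ pathObj Y)
    (w : h ≫ evalAt Y 1 = k ≫ evalAt Y 0) : X ⟶ pathObj Y :=
  toPath (fun x t => if (t : ℝ) ≤ 1 / 2 then pt (h.right x) (clamp (2 * t))
      else pt (k.right x) (clamp (2 * t - 1)))
    (by
      refine Continuous.if_le (by fun_prop) (by fun_prop) (by fun_prop) (by fun_prop) ?_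
      rintro ⟨x, t⟩ (ht : (t : ℝ) = 1 / 2)
      have := congr_arg (fun f => f.right x) w
      simp only [Under.comp_right, ConcreteCategory.comp_apply, evalAt_apply] at this
      simp only [ht]
      rw [clamp_of_one_le (by norm_num), clamp_of_le_zero (by norm_num), this])
    (by
      intro t x y hxy
      dsimp only
      split_ifs
      · exact pt_right_mono h _ hxy
      · exact pt_right_mono k _ hxy)
    (by
      intro c t
      split_ifs
      · exact pt_right_hom h c _
      · exact pt_right_hom k c _)

section

variable {X Y : UnderPo C} {f g l : X ⟶ Y} {h k : X ⟶ pathObj Y}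

lemma pt_transPath_of_le (w : h ≫ evalAt Y 1 = k ≫ evalAt Y 0) (x : X.right) {t : I}
    (ht : (t : ℝ) ≤ 1 / 2) : pt ((transPath h k w).right x) t = pt (h.right x) (clamp (2 * t)) :=
  if_pos ht

lemma pt_transPath_of_ge (w : h ≫ evalAt Y 1 = k ≫ evalAt Y 0) (x : X.right) {t : I}
    (ht : 1 / 2 ≤ (t : ℝ)) :
    pt ((transPath h k w).right x) t = pt (k.right x) (clamp (2 * t - 1)) := by
  rcases ht.eq_or_lt with ht | ht
  · have := congr_arg (fun f => f.right x) w
    simp only [Under.comp_right, ConcreteCategory.comp_apply, evalAt_apply] at this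
    rw [pt_transPath_of_le w x ht.ge, ← ht, clamp_of_one_le (by norm_num),
      clamp_of_le_zero (by norm_num), this]
  · exact if_neg ht.not_ge

lemma IsHomotopy.trans (w : IsHomotopy h f g) (w' : IsHomotopy k g l) :
    IsHomotopy (transPath h k (w.one.trans w'.zero.symm)) f l := by
  refine .mk' (fun x => ?_) (fun x => ?_)
  · rw [pt_transPath_of_le _ _ (by simp), clamp_of_le_zero (by simp), w.pt_zero]
  · rw [pt_transPath_of_ge _ _ (by norm_num), clamp_of_one_le (by norm_num), w'.pt_one]

end

lemma dihomotopic_iff {X Y : UnderPo C} {f g : X ⟶ Y} :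
    Dihomotopic f g ↔ ∃ h : X ⟶ pathObj Y, IsHomotopy h f g := by
  constructor
  · rintro ⟨H, h0, h1, hC⟩
    exact ⟨toPath (fun x t => H (x, t)) (map_continuous (ConcreteCategory.hom H))
      (fun t _ _ w => (ConcreteCategory.hom H).monotone' ⟨w, rfl⟩) hC, .mk' h0 h1⟩
  · rintro ⟨h, w⟩
    refine ⟨PoTop.ofHom
      { toFun := fun p => pt (h.right p.1) p.2
        monotone' := ?_
        continuous_toFun := ?_ }, w.pt_zero, w.pt_one, pt_right_hom h⟩
    · rintro ⟨x, s⟩ ⟨y, t⟩ ⟨hxy, rfl : s = t⟩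
      exact pt_right_mono h _ hxy
    · have : Continuous fun p : X.right × I => pt (h.right p.1) p.2 := by fun_prop
      exact this

variable (C) in
/-- The relation of being dihomotopic relative to `(C,≤)`, on all hom sets. -/
def dihomotopyRel : HomRel (UnderPo C) := fun _ _ f g => Dihomotopic f g

instance dihomotopyRel_congruence : Congruence (dihomotopyRel C) where
  equivalence :=
    { refl := fun f => dihomotopic_iff.2 ⟨_, .const f⟩
      symm := fun w => by
        obtain ⟨h, w⟩ := dihomotopic_iff.1 w
        exact dihomotopic_iff.2 ⟨_, w.symm⟩
      trans := fun w w' => by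
        obtain ⟨h, w⟩ := dihomotopic_iff.1 w
        obtain ⟨h', w'⟩ := dihomotopic_iff.1 w'
        exact dihomotopic_iff.2 ⟨_, w.trans w'⟩ }
  comp_left f _ _ w := by
    obtain ⟨h, w⟩ := dihomotopic_iff.1 w
    exact dihomotopic_iff.2 ⟨_, w.precomp f⟩
  comp_right g w := by
    obtain ⟨h, w⟩ := dihomotopic_iff.1 w
    exact dihomotopic_iff.2 ⟨_, w.postcomp g⟩

variable (C) in
/-- The functor from `(C,≤)`-pospaces to their homotopy category, the quotient by the relation of
being dihomotopic relative to `(C,≤)`. -/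
def toHo : UnderPo C ⥤ CategoryTheory.Quotient (dihomotopyRel C) :=
  CategoryTheory.Quotient.functor _

instance : (toHo C).Full := inferInstanceAs (CategoryTheory.Quotient.functor _).Full

lemma toHo_map_eq_iff {X Y : UnderPo C} {f g : X ⟶ Y} :
    (toHo C).map f = (toHo C).map g ↔ Dihomotopic f g :=
  CategoryTheory.Quotient.functor_map_eq_iff _ f g

lemma dihomotopyEquivalences_eq :
    dihomotopyEquivalences C = (MorphismProperty.isomorphisms _).inverseImage (toHo C) := by
  ext X Y f
  constructor
  · rintro ⟨g, h, h'⟩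
    exact ⟨(toHo C).map g,
      by rwa [← Functor.map_comp, ← CategoryTheory.Functor.map_id, toHo_map_eq_iff],
      by rwa [← Functor.map_comp, ← CategoryTheory.Functor.map_id, toHo_map_eq_iff]⟩
  · rintro ⟨g, h, h'⟩
    obtain ⟨g, rfl⟩ := (toHo C).map_surjective g
    exact ⟨g, by rwa [← toHo_map_eq_iff, Functor.map_comp, CategoryTheory.Functor.map_id],
      by rwa [← toHo_map_eq_iff, Functor.map_comp, CategoryTheory.Functor.map_id]⟩

instance : (dihomotopyEquivalences C).HasTwoOutOfThreeProperty := by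
  rw [dihomotopyEquivalences_eq]
  infer_instance

instance : (dihomotopyEquivalences C).RespectsIso := by
  rw [dihomotopyEquivalences_eq]
  infer_instance

instance : (dihomotopyEquivalences C).ContainsIdentities := by
  rw [dihomotopyEquivalences_eq]
  infer_instance

lemma dihomotopyEquivalences_of_homotopies {X Y : UnderPo C} {f : X ⟶ Y} (g : Y ⟶ X)
    {h : Y ⟶ pathObj Y} {k : X ⟶ pathObj X} (wh : IsHomotopy h (𝟙 Y) (g ≫ f))
    (wk : IsHomotopy k (𝟙 X) (f ≫ g)) : dihomotopyEquivalences C f :=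
  ⟨g, dihomotopic_iff.2 ⟨_, wh.symm⟩, dihomotopic_iff.2 ⟨_, wk.symm⟩⟩

/-! ### The cylinder and the path object are adjoint -/

lemma continuous_cylMk (X : UnderPo C) : Continuous fun p : X.right × I => cylMk X p :=
  continuous_coinduced_rng

lemma cylMk_hom (X : UnderPo C) (c : C) (t : I) :
    cylMk X (X.hom c, t) = (cyl X).hom c :=
  Quotient.sound (Or.inr ⟨c, rfl, rfl⟩)

/-- The morphism to the path object which corresponds to a morphism out of the cylinder. -/
def curry {X Y : UnderPo C} (k : cyl X ⟶ Y) : X ⟶ pathObj Y :=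
  toPath (fun x t => k.right (cylMk X (x, t)))
    ((continuous_right k).comp (continuous_cylMk X))
    (fun _ _ _ h => monotone_right k (Or.inl ⟨h, le_rfl⟩))
    (fun c t => by rw [cylMk_hom, right_hom_apply])

/-- The morphism out of the cylinder which corresponds to a morphism to the path object. -/
def uncurry {X Y : UnderPo C} (h : X ⟶ pathObj Y) : cyl X ⟶ Y :=
  mkHom (X := cyl X)
    (Quotient.lift (fun p : X.right × I => pt (h.right p.1) p.2) (by
      rintro ⟨x, s⟩ ⟨y, t⟩ (w | ⟨c, rfl : x = _, rfl : y = _⟩)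
      · rw [w]
      · exact (pt_right_hom h c s).trans (pt_right_hom h c t).symm))
    (continuous_coinduced_dom.2 (by
      have : Continuous fun p : X.right × I => pt (h.right p.1) p.2 := by fun_prop
      exact this))
    (by
      rintro ⟨x, s⟩ ⟨y, t⟩ (⟨w, rfl : s = t⟩ | ⟨c, w : x ≤ _, w' : _ ≤ y⟩)
      · exact pt_right_mono h s w
      · calc pt (h.right x) s ≤ pt (h.right (X.hom c)) s := pt_right_mono h s w
          _ = pt (h.right (X.hom c)) t :=
            (pt_right_hom h c s).trans (pt_right_hom h c t).symm
          _ ≤ pt (h.right y) t := pt_right_mono h t w')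
    (fun c => pt_right_hom h c 0)

@[simp]
lemma pt_curry {X Y : UnderPo C} (k : cyl X ⟶ Y) (x : X.right) (t : I) :
    pt ((curry k).right x) t = k.right (cylMk X (x, t)) := rfl

lemma cyl_hom_ext {X Y : UnderPo C} {k l : cyl X ⟶ Y}
    (h : ∀ (x : X.right) (t : I), k.right (cylMk X (x, t)) = l.right (cylMk X (x, t))) : k = l :=
  hom_ext_apply (by rintro ⟨x, t⟩; exact h x t)

@[simp]
lemma curry_uncurry {X Y : UnderPo C} (h : X ⟶ pathObj Y) : curry (uncurry h) = h :=
  path_hom_ext fun _ _ => rfl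

@[simp]
lemma uncurry_curry {X Y : UnderPo C} (k : cyl X ⟶ Y) : uncurry (curry k) = k :=
  cyl_hom_ext fun _ _ => rfl

/-- The inclusion `x ↦ [x,t]` into the cylinder. -/
def cylIn (X : UnderPo C) (t : I) : X ⟶ cyl X := curry (𝟙 (cyl X)) ≫ evalAt _ t

@[simp]
lemma cylIn_apply (X : UnderPo C) (t : I) (x : X.right) : (cylIn X t).right x = cylMk X (x, t) :=
  rfl

@[simp]
lemma curry_evalAt {X Y : UnderPo C} (k : cyl X ⟶ Y) (t : I) :
    curry k ≫ evalAt Y t = cylIn X t ≫ k := rfl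

@[simp]
lemma cylIn_uncurry {X Y : UnderPo C} (h : X ⟶ pathObj Y) (t : I) :
    cylIn X t ≫ uncurry h = h ≫ evalAt Y t := rfl

lemma curry_comp {X Y Z : UnderPo C} (k : cyl X ⟶ Y) (f : Y ⟶ Z) :
    curry (k ≫ f) = curry k ≫ pathMap f := rfl

/-! ### Difibrations and the mapping path object -/

/-- A difibration is a morphism with the homotopy lifting property. -/
lemma difibrations_iff {E B : UnderPo C} {p : E ⟶ B} : difibrations C p ↔
    ∀ (X : UnderPo C) (u : X ⟶ E) (h : X ⟶ pathObj B), h ≫ evalAt B 0 = u ≫ p →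
      ∃ H : X ⟶ pathObj E, H ≫ evalAt E 0 = u ∧ H ≫ pathMap p = h := by
  constructor
  · intro hp X u h w
    have := hp X
    have sq : CommSq u (cylIn0 X) p (uncurry h) := ⟨w.symm⟩
    refine ⟨curry sq.lift, sq.fac_left, ?_⟩
    rw [← curry_comp, sq.fac_right, curry_uncurry]
  · intro hp X
    refine ⟨fun {u v} sq => ?_⟩
    obtain ⟨H, h0, h1⟩ := hp X u (curry v) sq.w.symm
    refine ⟨⟨⟨uncurry H, h0, ?_⟩⟩⟩
    rw [← uncurry_curry v, ← h1, ← uncurry_curry (uncurry H ≫ p), curry_comp, curry_uncurry]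

/-- The pospace of the pairs of a point `x` of `X` and a path in `Y` that starts at `f x`. -/
def mappingPathSpace {X Y : UnderPo C} (f : X ⟶ Y) : PoTop.{u} :=
  PoTop.of {q : X.right × (pathObj Y).right // pt q.2 0 = f.right q.1}

/-- The mapping path object of `f : X ⟶ Y`: pairs of a point `x` of `X` and a path in `Y` that
starts at `f x`. -/
def mappingPath {X Y : UnderPo C} (f : X ⟶ Y) : UnderPo C :=
  Under.mk (Y := mappingPathSpace f) (PoTop.ofHom
    { toFun := fun c => ⟨(X.hom c, (pathObj Y).hom c), (right_hom_apply f c).symm⟩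
      monotone' := fun _ _ h => ⟨(ConcreteCategory.hom X.hom).monotone' h,
        (ConcreteCategory.hom (pathObj Y).hom).monotone' h⟩
      continuous_toFun :=
        ((map_continuous (ConcreteCategory.hom X.hom)).prodMk
          (map_continuous (ConcreteCategory.hom (pathObj Y).hom))).subtype_mk _ })

namespace mappingPath

variable {X Y Z : UnderPo C} (f : X ⟶ Y)

/-- The projection of the mapping path object to the source. -/
def fst : mappingPath f ⟶ X :=
  mkHom (X := mappingPath f) (fun q => q.1.1) (continuous_fst.comp continuous_subtype_val)
    (fun _ _ h => h.1) (fun _ => rfl)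

/-- The projection of the mapping path object to the paths in the target. -/
def snd : mappingPath f ⟶ pathObj Y :=
  mkHom (X := mappingPath f) (fun q => q.1.2) (continuous_snd.comp continuous_subtype_val)
    (fun _ _ h => h.2) (fun _ => rfl)

variable {f}

lemma ext {q r : (mappingPath f).right} (h : (fst f).right q = (fst f).right r)
    (h' : ∀ t, pt ((snd f).right q) t = pt ((snd f).right r) t) : q = r :=
  Subtype.ext (Prod.ext h (pt_ext h'))

lemma pt_snd_zero (q : (mappingPath f).right) :
    pt ((snd f).right q) 0 = f.right ((fst f).right q) := q.2

lemma condition : snd f ≫ evalAt Y 0 = fst f ≫ f := hom_ext_apply pt_snd_zero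

/-- The point of the mapping path object with given components. -/
def mk (x : X.right) (γ : (pathObj Y).right) (h : pt γ 0 = f.right x) : (mappingPath f).right :=
  ⟨(x, γ), h⟩

lemma continuous_mk {S : Type*} [TopologicalSpace S] {x : S → X.right}
    {γ : S → (pathObj Y).right} (hx : Continuous x) (hγ : Continuous γ)
    (h : ∀ s, pt (γ s) 0 = f.right (x s)) : Continuous fun s => mk (x s) (γ s) (h s) :=
  Continuous.subtype_mk (hx.prodMk hγ) _

lemma mk_le_mk {x x' : X.right} {γ γ' : (pathObj Y).right} {h : pt γ 0 = f.right x}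
    {h' : pt γ' 0 = f.right x'} (hx : x ≤ x') (hγ : ∀ t, pt γ t ≤ pt γ' t) :
    mk x γ h ≤ mk x' γ' h' := ⟨hx, hγ⟩

end mappingPath

/-- A difibration has a path lifting function, which is itself a morphism under `C`. -/
lemma difibrations.exists_pathLifting {E B : UnderPo C} {p : E ⟶ B} (hp : difibrations C p) :
    ∃ l : mappingPath p ⟶ pathObj E,
      l ≫ evalAt E 0 = mappingPath.fst p ∧ l ≫ pathMap p = mappingPath.snd p :=
  difibrations_iff.1 hp _ _ _ mappingPath.condition

/-- The point reached from `a` after moving towards `b` for the time `r` with unit speed. -/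
noncomputable def moveTo (a b : I) (r : I) : I :=
  clamp (a + max (-r : ℝ) (min (r : ℝ) (b - a)))

@[fun_prop]
lemma continuous_moveTo {S : Type*} [TopologicalSpace S] {a b r : S → I} (ha : Continuous a)
    (hb : Continuous b) (hr : Continuous r) : Continuous fun s => moveTo (a s) (b s) (r s) := by
  unfold moveTo
  fun_prop

lemma moveTo_zero (a b : I) : moveTo a b 0 = a := by
  rw [moveTo, Set.Icc.coe_zero, neg_zero, max_eq_left (min_le_left _ _), add_zero, clamp_coe]

lemma moveTo_self_dist (a b : I) : moveTo a b (clamp |(b : ℝ) - a|) = b := by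
  have h : |(b : ℝ) - a| ≤ 1 := abs_le.2
    ⟨by linarith [b.2.1, a.2.2], by linarith [b.2.2, a.2.1]⟩
  rw [moveTo, coe_clamp, min_eq_right h, max_eq_right (a := 0) (abs_nonneg _),
    min_eq_right (le_abs_self _), max_eq_right (neg_abs_le _), add_sub_cancel, clamp_coe]

/-- If a family of paths `U` in the total space of a difibration lies over the path `h` traversed
according to `a`, then it can be deformed, without moving the points at times `t` with
`a t = b t`, to one that lies over `h` traversed according to `b`: lift the path along `h` from
`h (a t)` to `h (b t)` that runs with unit speed, and stop after the time `|b t - a t|`. -/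
lemma difibrations.exists_reparam {E B X : UnderPo C} {p : E ⟶ B} (hp : difibrations C p)
    (U : X ⟶ pathObj E) (h : X ⟶ pathObj B) (a b : C(I, I))
    (w : ∀ x t, p.right (pt (U.right x) t) = pt (h.right x) (a t)) :
    ∃ V : X ⟶ pathObj E, (∀ x t, p.right (pt (V.right x) t) = pt (h.right x) (b t)) ∧
      ∀ t, a t = b t → ∀ x, pt (V.right x) t = pt (U.right x) t := by
  obtain ⟨l, l0, l1⟩ := hp.exists_pathLifting
  have l0' : ∀ q, pt (l.right q) 0 = (mappingPath.fst p).right q := by simp [← l0]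
  have l1' : ∀ q t, p.right (pt (l.right q) t) = pt ((mappingPath.snd p).right q) t := by
    simp [← l1]
  let γ (x : X.right) (t : I) : (pathObj B).right :=
    mkPt (fun r => pt (h.right x) (moveTo (a t) (b t) r)) (by fun_prop)
  have hγ (x : X.right) (t : I) : pt (γ x t) 0 = p.right (pt (U.right x) t) := by
    simp [γ, moveTo_zero, w]
  have hγc : Continuous fun q : X.right × I => γ q.1 q.2 :=
    continuous_mkPt (fun (q : X.right × I) r => pt (h.right q.1) (moveTo (a q.2) (b q.2) r))
      (by fun_prop)
  let q (x : X.right) (t : I) : (mappingPath p).right :=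
    mappingPath.mk (pt (U.right x) t) (γ x t) (hγ x t)
  have hq : Continuous fun z : X.right × I => q z.1 z.2 :=
    mappingPath.continuous_mk (by fun_prop) hγc _
  have hm (t : I) : Monotone fun x => pt (l.right (q x t)) (clamp |(b t : ℝ) - a t|) :=
    fun x y hxy => pt_right_mono l _
      (mappingPath.mk_le_mk (pt_right_mono U t hxy) fun r => pt_right_mono h _ hxy)
  refine ⟨toPath (fun x t => pt (l.right (q x t)) (clamp |(b t : ℝ) - a t|)) (by fun_prop) hm ?_,
    ?_, ?_⟩
  · intro c t
    have : q (X.hom c) t = (mappingPath p).hom c := by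
      refine mappingPath.ext (pt_right_hom U c t) fun r => ?_
      change pt (h.right (X.hom c)) _ = _
      rw [pt_right_hom, right_hom_apply, pt_hom]
    rw [this, pt_right_hom]
  · intro x t
    rw [pt_toPath, l1']
    change pt (h.right x) _ = _
    rw [moveTo_self_dist]
  · intro t ht x
    rw [pt_toPath, ht, sub_self, abs_zero, clamp_of_le_zero le_rfl, l0']
    rfl

/-! ### Trivial difibrations -/

/-- Dold's theorem: a difibration which is a relative dihomotopy equivalence is shrinkable, that is,
it has a section `s`, and `s p` is homotopic to the identity over the base. -/
lemma exists_section_of_trivial {E B : UnderPo C} {p : E ⟶ B} (hp : difibrations C p)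
    (hp' : dihomotopyEquivalences C p) :
    ∃ (s : B ⟶ E) (D : E ⟶ pathObj E), s ≫ p = 𝟙 B ∧ IsHomotopy D (𝟙 E) (p ≫ s) ∧
      D ≫ pathMap p = p ≫ constPath B := by
  obtain ⟨g, hg, hg'⟩ := hp'
  obtain ⟨k, hk⟩ := dihomotopic_iff.1 hg
  obtain ⟨K, K0, K1⟩ := difibrations_iff.1 hp _ g k hk.zero
  obtain ⟨s, hs⟩ : ∃ s, s = K ≫ evalAt E 1 := ⟨_, rfl⟩
  have hsp : s ≫ p = 𝟙 B := by
    rw [← hk.one, ← K1, hs]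
    rfl
  have hgs : Dihomotopic g s := dihomotopic_iff.2 ⟨K, K0, hs.symm⟩
  have : Dihomotopic (𝟙 E) (p ≫ s) := by
    rw [← toHo_map_eq_iff] at hg' hgs ⊢
    rw [← hg', Functor.map_comp, Functor.map_comp, hgs]
  obtain ⟨D, hD⟩ := dihomotopic_iff.1 this
  have hD' : IsHomotopy (symmPath (D ≫ pathMap (p ≫ s))) (p ≫ s) (p ≫ s) := by
    have := (hD.postcomp (p ≫ s)).symm
    rwa [Category.id_comp, Category.assoc, reassoc_of% hsp] at this
  have hsp' : ∀ y, p.right (s.right y) = y := fun y => by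
    have := congr_arg (fun f => f.right y) hsp
    simpa using this
  -- The loop `p D (p D)⁻¹` is the path `p D` traversed according to `t ↦ min (2t) (2 - 2t)`.
  obtain ⟨V, hV, hV'⟩ := hp.exists_reparam (transPath D _ (hD.one.trans hD'.zero.symm))
    (D ≫ pathMap p) ⟨fun t => clamp (min (2 * t) (2 - 2 * t)), by fun_prop⟩
    (ContinuousMap.const I 0) (by
      intro x t
      rcases le_total (t : ℝ) (1 / 2) with ht | ht
      · rw [pt_transPath_of_le _ _ ht]
        simp [min_eq_left (show (2 * t : ℝ) ≤ 2 - 2 * t by linarith)]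
      · rw [pt_transPath_of_ge _ _ ht]
        have e : σ (clamp (2 * t - 1)) = clamp (2 - 2 * t) := by
          ext
          have := t.2.2
          rw [coe_symm_eq, coe_clamp, coe_clamp, min_eq_right (by linarith),
            max_eq_right (by linarith), min_eq_right (by linarith), max_eq_right (by linarith)]
          ring
        simp [min_eq_right (show (2 - 2 * t : ℝ) ≤ 2 * t by linarith), hsp', e])
  refine ⟨s, V, hsp, .mk' (fun x => ?_) (fun x => ?_), path_hom_ext fun x t => ?_⟩
  · rw [hV' _ (by simp), (hD.trans hD').pt_zero]
  · rw [hV' _ (by simp), (hD.trans hD').pt_one]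
  · simpa [hD.pt_zero] using hV x t

/-- Homotopies lift along trivial difibrations with both ends prescribed. -/
lemma exists_lift_of_trivial {E B X : UnderPo C} {p : E ⟶ B} (hp : difibrations C p)
    (hp' : dihomotopyEquivalences C p) {u v : X ⟶ E} {h : X ⟶ pathObj B}
    (w : IsHomotopy h (u ≫ p) (v ≫ p)) :
    ∃ H : X ⟶ pathObj E, IsHomotopy H u v ∧ H ≫ pathMap p = h := by
  obtain ⟨s, D, hsp, hD, hDp⟩ := exists_section_of_trivial hp hp'
  have hsp' : ∀ y, p.right (s.right y) = y := fun y => by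
    have := congr_arg (fun f => f.right y) hsp
    simpa using this
  have hDp' : ∀ y t, p.right (pt (D.right y) t) = p.right y := fun y t => by
    have := congr_arg (fun f => pt (f.right y) t) hDp
    simpa using this
  have w1 : IsHomotopy (u ≫ D) u (u ≫ p ≫ s) := by simpa using hD.precomp u
  have w2 : IsHomotopy (h ≫ pathMap s) (u ≫ p ≫ s) (v ≫ p ≫ s) := by simpa using w.postcomp s
  have w3 : IsHomotopy (symmPath (v ≫ D)) (v ≫ p ≫ s) v := by simpa using (hD.precomp v).symm
  have w4 := w2.trans w3
  have w5 := w1.trans w4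
  -- The path `D(u) s(h) D(v)⁻¹` lies over `h` with waiting times `1/2` before and `1/4` after it.
  obtain ⟨V, hV, hV'⟩ := hp.exists_reparam _ h ⟨fun t => clamp (4 * t - 2), by fun_prop⟩
    (ContinuousMap.id I) (by
      intro x t
      rcases le_total (t : ℝ) (1 / 2) with ht | ht
      · rw [pt_transPath_of_le (w1.one.trans w4.zero.symm) _ ht]
        simp [hDp', clamp_of_le_zero (show (4 * t - 2 : ℝ) ≤ 0 by linarith), w.pt_zero]
      · rw [pt_transPath_of_ge (w1.one.trans w4.zero.symm) _ ht]
        have e : (clamp (2 * t - 1) : ℝ) = 2 * t - 1 := by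
          have := t.2.2
          rw [coe_clamp, min_eq_right (by linarith), max_eq_right (by linarith)]
        rcases le_total (clamp (2 * t - 1) : ℝ) (1 / 2) with ht' | ht'
        · rw [pt_transPath_of_le (w2.one.trans w3.zero.symm) _ ht', e]
          simp [hsp', show (2 * (2 * t - 1) : ℝ) = 4 * t - 2 by ring]
        · rw [pt_transPath_of_ge (w2.one.trans w3.zero.symm) _ ht']
          rw [e] at ht'
          simp [hDp', clamp_of_one_le (show (1 : ℝ) ≤ 4 * t - 2 by linarith), w.pt_one])
  refine ⟨V, .mk' (fun x => ?_) (fun x => ?_), path_hom_ext fun x t => ?_⟩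
  · rw [hV' _ (by simp [clamp_of_le_zero]), w5.pt_zero]
  · rw [hV' _ (by
      simp only [ContinuousMap.coe_mk, ContinuousMap.id_apply]
      exact clamp_of_one_le (by norm_num)), w5.pt_one]
  · simpa using hV x t

/-! ### Pushouts -/

section Pushout

variable {A X Y : UnderPo C} (i : A ⟶ X) (f : A ⟶ Y)

/-- The preorder on `X ⊕ Y` whose quotient poset underlies the pushout: `a ≤ b` if this holds
in every poset to which `X` and `Y` are mapped monotonically and compatibly. -/
def PushoutLE (a b : X.right ⊕ Y.right) : Prop :=
  ∀ (P : Type u) [PartialOrder P] (φ : X.right → P) (ψ : Y.right → P), Monotone φ → Monotone ψ →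
    (∀ a : A.right, φ (i.right a) = ψ (f.right a)) → Sum.elim φ ψ a ≤ Sum.elim φ ψ b

/-- The equivalence relation of the preorder `PushoutLE`. -/
def pushoutSetoid : Setoid (X.right ⊕ Y.right) where
  r a b := PushoutLE i f a b ∧ PushoutLE i f b a
  iseqv :=
    { refl := fun _ => ⟨fun _ _ _ _ _ _ _ => le_rfl, fun _ _ _ _ _ _ _ => le_rfl⟩
      symm := fun h => ⟨h.2, h.1⟩
      trans := fun h k => ⟨fun P _ φ ψ m m' w => (h.1 P φ ψ m m' w).trans (k.1 P φ ψ m m' w),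
        fun P _ φ ψ m m' w => (k.2 P φ ψ m m' w).trans (h.2 P φ ψ m m' w)⟩ }

/-- The underlying set of the pushout. -/
def PushoutSpace : Type u := Quotient (pushoutSetoid i f)

/-- The projection from the disjoint union to the pushout. -/
def pushoutMk (a : X.right ⊕ Y.right) : PushoutSpace i f := Quotient.mk (pushoutSetoid i f) a

instance : TopologicalSpace (PushoutSpace i f) :=
  TopologicalSpace.coinduced (pushoutMk i f) inferInstance

instance : PartialOrder (PushoutSpace i f) where
  le := Quotient.lift₂ (PushoutLE i f) fun a b a' b' h k => propext
    ⟨fun l P _ φ ψ m m' w =>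
      (h.2 P φ ψ m m' w).trans ((l P φ ψ m m' w).trans (k.1 P φ ψ m m' w)),
      fun l P _ φ ψ m m' w =>
      (h.1 P φ ψ m m' w).trans ((l P φ ψ m m' w).trans (k.2 P φ ψ m m' w))⟩
  le_refl := by
    rintro ⟨a⟩ P _ φ ψ m m' w
    exact le_rfl
  le_trans := by
    rintro ⟨a⟩ ⟨b⟩ ⟨c⟩ h k P _ φ ψ m m' w
    exact (h P φ ψ m m' w).trans (k P φ ψ m m' w)
  le_antisymm := by
    rintro ⟨a⟩ ⟨b⟩ h k
    exact Quotient.sound ⟨h, k⟩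

lemma pushoutMk_inl_mono : Monotone fun x : X.right => pushoutMk i f (Sum.inl x) :=
  fun _ _ h _ _ _ _ m _ _ => m h

lemma pushoutMk_inr_mono : Monotone fun y : Y.right => pushoutMk i f (Sum.inr y) :=
  fun _ _ h _ _ _ _ _ m _ => m h

lemma pushoutMk_glue (a : A.right) :
    pushoutMk i f (Sum.inl (i.right a)) = pushoutMk i f (Sum.inr (f.right a)) :=
  Quotient.sound ⟨fun _ _ _ _ _ _ w => (w a).le, fun _ _ _ _ _ _ w => (w a).ge⟩

lemma continuous_pushoutMk : Continuous (pushoutMk i f) := continuous_coinduced_rng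

/-- The pushout of `(C,≤)`-pospaces. -/
def pushoutObj : UnderPo C :=
  Under.mk (Y := PoTop.of (PushoutSpace i f)) (PoTop.ofHom
    { toFun := fun c => pushoutMk i f (Sum.inl (X.hom c))
      monotone' := (pushoutMk_inl_mono i f).comp (ConcreteCategory.hom X.hom).monotone'
      continuous_toFun := (continuous_pushoutMk i f).comp
        (continuous_inl.comp (map_continuous (ConcreteCategory.hom X.hom))) })

/-- The first inclusion into the pushout. -/
def pushoutInl : X ⟶ pushoutObj i f :=
  mkHom (Y := pushoutObj i f) (fun x => pushoutMk i f (Sum.inl x))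
    ((continuous_pushoutMk i f).comp continuous_inl) (pushoutMk_inl_mono i f) (fun _ => rfl)

/-- The second inclusion into the pushout. -/
def pushoutInr : Y ⟶ pushoutObj i f :=
  mkHom (Y := pushoutObj i f) (fun y => pushoutMk i f (Sum.inr y))
    ((continuous_pushoutMk i f).comp continuous_inr) (pushoutMk_inr_mono i f) (fun c => by
      rw [← right_hom_apply f c, ← pushoutMk_glue, right_hom_apply]
      rfl)

variable {i f} in
/-- The morphism out of the pushout with given components. -/
def pushoutDesc {Z : UnderPo C} (k : X ⟶ Z) (l : Y ⟶ Z) (w : i ≫ k = f ≫ l) :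
    pushoutObj i f ⟶ Z :=
  have w' (a : A.right) : k.right (i.right a) = l.right (f.right a) := by
    have := congr_arg (fun f => f.right a) w
    simpa using this
  mkHom (X := pushoutObj i f)
    (Quotient.lift (Sum.elim (fun x => k.right x) (fun y => l.right y)) fun _ _ h =>
      le_antisymm (h.1 _ _ _ (monotone_right k) (monotone_right l) w')
        (h.2 _ _ _ (monotone_right k) (monotone_right l) w'))
    (continuous_coinduced_dom.2 (by
      have : Continuous (Sum.elim (fun x => k.right x) (fun y => l.right y)) := by fun_prop
      exact this))
    (by
      rintro ⟨a⟩ ⟨b⟩ h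
      exact h _ _ _ (monotone_right k) (monotone_right l) w')
    (fun c => right_hom_apply k c)

lemma pushoutObj_isPushout : IsPushout i f (pushoutInl i f) (pushoutInr i f) where
  w := hom_ext_apply (pushoutMk_glue i f)
  isColimit' := ⟨PushoutCocone.IsColimit.mk _ (fun s => pushoutDesc s.inl s.inr s.condition)
    (fun _ => rfl) (fun _ => rfl) (fun s m h h' => hom_ext_apply (by
      rintro ⟨x | y⟩
      · exact congr_arg (fun g => g.right x) h
      · exact congr_arg (fun g => g.right y) h'))⟩

end Pushout

instance : HasPushouts (UnderPo C) :=
  haveI {A X Y : UnderPo C} {i : A ⟶ X} {f : A ⟶ Y} : HasColimit (span i f) :=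
    (pushoutObj_isPushout i f).hasPushout
  hasPushouts_of_hasColimit_span _

instance : HasInitial (UnderPo C) := Under.mkIdInitial.hasInitial

instance : HasBinaryCoproducts (UnderPo C) := hasBinaryCoproducts_of_hasInitial_and_pushouts _

/-! ### The homotopy extension property -/

/-- The morphism to the paths of paths which corresponds to a two-parameter family. -/
def toPath₂ {X Y : UnderPo C} (F : X.right → I → I → Y.right)
    (hF : Continuous fun p : (X.right × I) × I => F p.1.1 p.1.2 p.2)
    (hm : ∀ s t, Monotone fun x => F x s t) (hC : ∀ (c : C) s t, F (X.hom c) s t = Y.hom c) :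
    X ⟶ pathObj (pathObj Y) :=
  toPath (fun x s => mkPt (F x s) (hF.comp (Continuous.prodMk_right (x, s))))
    (continuous_mkPt (fun (p : X.right × I) t => F p.1 p.2 t) hF)
    (fun s _ _ h t => hm s t h) (fun c s => pt_ext (hC c s))

@[simp]
lemma pt_pt_toPath₂ {X Y : UnderPo C} (F : X.right → I → I → Y.right)
    (hF : Continuous fun p : (X.right × I) × I => F p.1.1 p.1.2 p.2)
    (hm : ∀ s t, Monotone fun x => F x s t) (hC : ∀ (c : C) s t, F (X.hom c) s t = Y.hom c)
    (x : X.right) (s t : I) : pt (pt ((toPath₂ F hF hm hC).right x) s) t = F x s t := rfl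

/-- The homotopy from the constant path at `γ 0` to `γ` through the initial parts of `γ`. -/
def contractPath (Y : UnderPo C) : pathObj Y ⟶ pathObj (pathObj Y) :=
  toPath₂ (fun γ s t => pt γ (s * t)) (by fun_prop) (fun _ _ _ _ h => pt_mono h _)
    (fun _ _ _ => rfl)

@[simp]
lemma pt_pt_contractPath (Y : UnderPo C) (γ : (pathObj Y).right) (s t : I) :
    pt (pt ((contractPath Y).right γ) s) t = pt γ (s * t) := rfl

lemma isHomotopy_contractPath (Y : UnderPo C) :
    IsHomotopy (contractPath Y) (evalAt Y 0 ≫ constPath Y) (𝟙 (pathObj Y)) :=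
  .mk' (fun γ => pt_ext fun t => by simp) (fun γ => pt_ext fun t => by simp)

lemma dihomotopyEquivalences_evalAt_zero (Y : UnderPo C) :
    dihomotopyEquivalences C (evalAt Y 0) :=
  ⟨constPath Y, dihomotopic_iff.2 ⟨_, .const (𝟙 Y)⟩,
    dihomotopic_iff.2 ⟨_, isHomotopy_contractPath Y⟩⟩

/-- Given paths `u x` and `h x` from the same point, the paths `t ↦ c ((1 + t - s) / 2)` on
the concatenation `c` of `(h x)⁻¹` and `u x` form a homotopy starting at `u x` along `h`. -/
lemma difibrations_evalAt_zero (Y : UnderPo C) : difibrations C (evalAt Y 0) := by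
  rw [difibrations_iff]
  intro X u h w
  have w0 : IsHomotopy u (u ≫ evalAt Y 0) (u ≫ evalAt Y 1) := ⟨rfl, rfl⟩
  have w1 : IsHomotopy (symmPath h) (h ≫ evalAt Y 1) (u ≫ evalAt Y 0) :=
    w ▸ IsHomotopy.symm ⟨rfl, rfl⟩
  obtain ⟨c, hc⟩ : ∃ c, c = transPath _ _ (w1.one.trans w0.zero.symm) := ⟨_, rfl⟩
  refine ⟨toPath₂ (fun x s t => pt (c.right x) (clamp ((1 + t - s) / 2))) (by fun_prop)
    (fun s t => pt_right_mono c _) (fun b s t => pt_right_hom c b _),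
    hom_ext_apply fun x => pt_ext fun t => ?_, path_hom_ext fun x s => ?_⟩
  · have e : (clamp ((1 + t) / 2) : ℝ) = (1 + t) / 2 := by
      rw [coe_clamp, min_eq_right (by linarith [t.2.2]), max_eq_right (by linarith [t.2.1])]
    have : pt (c.right x) (clamp ((1 + t) / 2)) = pt (u.right x) t := by
      rw [hc, pt_transPath_of_ge _ _ (by rw [e]; linarith [t.2.1]), e,
        show 2 * ((1 + t) / 2) - 1 = (t : ℝ) by ring, clamp_coe]
    simpa using this
  · have e : (clamp ((1 - s) / 2) : ℝ) = (1 - s) / 2 := by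
      rw [coe_clamp, min_eq_right (by linarith [s.2.1]), max_eq_right (by linarith [s.2.2])]
    have : pt (c.right x) (clamp ((1 - s) / 2)) = pt (h.right x) s := by
      rw [hc, pt_transPath_of_le _ _ (by rw [e]; linarith [s.2.1]), e,
        show 2 * ((1 - s) / 2) = ((σ s : I) : ℝ) by rw [coe_symm_eq]; ring, clamp_coe,
        pt_symmPath, symm_symm]
    simpa using this

/-- Dicofibrations have the homotopy extension property. -/
lemma dicofibrations.exists_extension {A X Y : UnderPo C} {i : A ⟶ X} (hi : dicofibrations C i)
    (u : X ⟶ Y) (h : A ⟶ pathObj Y) (w : h ≫ evalAt Y 0 = i ≫ u) :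
    ∃ H : X ⟶ pathObj Y, i ≫ H = h ∧ H ≫ evalAt Y 0 = u := by
  have := hi _ ⟨difibrations_evalAt_zero Y, dihomotopyEquivalences_evalAt_zero Y⟩
  have sq : CommSq h i (evalAt Y 0) u := ⟨w⟩
  exact ⟨sq.lift, sq.fac_left, sq.fac_right⟩

lemma fibrant (X : UnderPo C) :
    CofCat.Fibrant (dihomotopyEquivalences C) (dicofibrations C) X := by
  rintro Z i hi ⟨g, -, hg⟩
  obtain ⟨h, hh⟩ := dihomotopic_iff.1 hg
  obtain ⟨H, H0, H1⟩ := hi.exists_extension g h hh.zero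
  exact ⟨H ≫ evalAt X 1, by rw [reassoc_of% H0, hh.one]⟩

/-! ### Cobase change of weak equivalences -/

/-- The end point of the path. -/
def mappingPath.endpoint {X Y : UnderPo C} (f : X ⟶ Y) : mappingPath f ⟶ Y :=
  mappingPath.snd f ≫ evalAt Y 1

/-- The inclusion by constant paths. -/
def mappingPath.incl {X Y : UnderPo C} (f : X ⟶ Y) : X ⟶ mappingPath f :=
  mkHom (fun x => mappingPath.mk x ((f ≫ constPath Y).right x) rfl)
    (mappingPath.continuous_mk (by fun_prop) (by fun_prop) _)
    (fun _ _ h => mappingPath.mk_le_mk h fun t => pt_right_mono _ t h)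
    (fun c => mappingPath.ext rfl fun _ => right_hom_apply f c)

@[simp]
lemma mappingPath.pt_snd_incl {X Y : UnderPo C} (f : X ⟶ Y) (x : X.right) (t : I) :
    pt ((mappingPath.snd f).right ((mappingPath.incl f).right x)) t = f.right x := rfl

lemma mappingPath.incl_endpoint {X Y : UnderPo C} (f : X ⟶ Y) :
    mappingPath.incl f ≫ mappingPath.endpoint f = f := hom_ext_apply fun _ => rfl

/-- The homotopy of maps to the mapping path object which moves the path and fixes the point. -/
def mappingPath.deform {X Y Z : UnderPo C} {f : X ⟶ Y} (a : Z ⟶ X) (F : Z ⟶ pathObj (pathObj Y))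
    (w : ∀ z s, pt (pt (F.right z) s) 0 = f.right (a.right z)) : Z ⟶ pathObj (mappingPath f) :=
  toPath (fun z s => mappingPath.mk (a.right z) (pt (F.right z) s) (w z s))
    (mappingPath.continuous_mk (by fun_prop) (by fun_prop) _)
    (fun s _ _ h => mappingPath.mk_le_mk (monotone_right a h) (pt_right_mono F s h))
    (fun c s => mappingPath.ext (right_hom_apply a c)
      fun t => congr_arg (fun γ => pt γ t) (pt_right_hom F c s))

section

variable {X Y Z : UnderPo C} {f : X ⟶ Y} (a : Z ⟶ X) (F : Z ⟶ pathObj (pathObj Y))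
    (w : ∀ z s, pt (pt (F.right z) s) 0 = f.right (a.right z)) (z : Z.right) (s : I)

@[simp]
lemma mappingPath.fst_deform :
    (mappingPath.fst f).right (pt ((mappingPath.deform a F w).right z) s) = a.right z := rfl

@[simp]
lemma mappingPath.snd_deform :
    (mappingPath.snd f).right (pt ((mappingPath.deform a F w).right z) s) = pt (F.right z) s := rfl

end

/-- The end point of a path with given starting point can be moved freely: the lift at time `s` is
the concatenation `c` of the given path and of the path `h` of end points, up to the
time `(1 + s) / 2`. -/
lemma mappingPath.difibrations_endpoint {X Y : UnderPo C} (f : X ⟶ Y) :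
    difibrations C (mappingPath.endpoint f) := by
  rw [difibrations_iff]
  intro Z u h w
  have w0 : IsHomotopy (u ≫ mappingPath.snd f) (u ≫ mappingPath.fst f ≫ f)
      (u ≫ mappingPath.endpoint f) :=
    ⟨by rw [Category.assoc, mappingPath.condition], by rw [Category.assoc, mappingPath.endpoint]⟩
  have w1 : IsHomotopy h (u ≫ mappingPath.endpoint f) (h ≫ evalAt Y 1) := ⟨w, rfl⟩
  have wc := w0.trans w1
  obtain ⟨c, hc⟩ : ∃ c, c = transPath _ _ (w0.one.trans w1.zero.symm) := ⟨_, rfl⟩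
  rw [← hc] at wc
  refine ⟨mappingPath.deform (u ≫ mappingPath.fst f)
    (toPath₂ (fun x s t => pt (c.right x) (clamp (t * (1 + s) / 2))) (by fun_prop)
      (fun s t => pt_right_mono c _) (fun b s t => pt_right_hom c b _))
    (by simp [wc.pt_zero]),
    hom_ext_apply fun x => mappingPath.ext (by simp) fun t => ?_, path_hom_ext fun x s => ?_⟩
  · have e : (clamp (t / 2) : ℝ) = t / 2 := by
      rw [coe_clamp, min_eq_right (by linarith [t.2.2]), max_eq_right (by linarith [t.2.1])]
    have : pt (c.right x) (clamp (t / 2)) = pt ((u ≫ mappingPath.snd f).right x) t := by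
      rw [hc, pt_transPath_of_le _ _ (by rw [e]; linarith [t.2.2]), e,
        show 2 * (t / 2) = (t : ℝ) by ring, clamp_coe]
    simpa using this
  · have e : (clamp ((1 + s) / 2) : ℝ) = (1 + s) / 2 := by
      rw [coe_clamp, min_eq_right (by linarith [s.2.2]), max_eq_right (by linarith [s.2.1])]
    have : pt (c.right x) (clamp ((1 + s) / 2)) = pt (h.right x) s := by
      rw [hc, pt_transPath_of_ge _ _ (by rw [e]; linarith [s.2.1]), e,
        show 2 * ((1 + s) / 2) - 1 = (s : ℝ) by ring, clamp_coe]
    simpa [mappingPath.endpoint] using this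

/-- `j : A ⟶ M` is the inclusion of a strong deformation retract: it has a retraction `r`, and
`r j` is homotopic to the identity relative to `A`. -/
def IsStrongDeformationRetract {A M : UnderPo C} (j : A ⟶ M) : Prop :=
  ∃ (r : M ⟶ A) (h : M ⟶ pathObj M), j ≫ r = 𝟙 A ∧ IsHomotopy h (r ≫ j) (𝟙 M) ∧
    j ≫ h = j ≫ constPath M

lemma IsStrongDeformationRetract.dihomotopyEquivalences {A M : UnderPo C} {j : A ⟶ M}
    (hj : IsStrongDeformationRetract j) : dihomotopyEquivalences C j := by
  obtain ⟨r, h, hr, hh, -⟩ := hj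
  exact ⟨r, dihomotopic_iff.2 ⟨h, hh⟩, hr ▸ dihomotopic_iff.2 ⟨_, .const _⟩⟩

lemma IsStrongDeformationRetract.cobaseChange {A M X Z : UnderPo C} {j : A ⟶ M} {i : A ⟶ X}
    {i' : M ⟶ Z} {j' : X ⟶ Z} (sq : IsPushout j i i' j') (hj : IsStrongDeformationRetract j) :
    IsStrongDeformationRetract j' := by
  obtain ⟨r, h, hr, hh, hj⟩ := hj
  obtain ⟨r', hr1, hr2⟩ := sq.exists_desc (r ≫ i) (𝟙 X) (by simp [reassoc_of% hr])
  obtain ⟨h', hh1, hh2⟩ := sq.exists_desc (h ≫ pathMap i') (j' ≫ constPath Z) (by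
    rw [reassoc_of% hj, ← reassoc_of% sq.w]
    rfl)
  have hh' := hh.postcomp i'
  refine ⟨r', h', hr2, ⟨sq.hom_ext ?_ ?_, sq.hom_ext ?_ ?_⟩, hh2⟩
  · rw [reassoc_of% hh1, reassoc_of% hr1, ← sq.w, ← Category.assoc, hh'.zero, Category.assoc]
  · rw [reassoc_of% hh2, reassoc_of% hr2]
    rfl
  · rw [reassoc_of% hh1, ← Category.assoc, hh'.one, Category.id_comp, Category.comp_id]
  · rw [reassoc_of% hh2]
    rfl

lemma mappingPath.isStrongDeformationRetract_incl {X Y : UnderPo C} (f : X ⟶ Y) :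
    IsStrongDeformationRetract (mappingPath.incl f) := by
  refine ⟨mappingPath.fst f, mappingPath.deform (mappingPath.fst f)
    (mappingPath.snd f ≫ contractPath Y) (by simp [mappingPath.pt_snd_zero]),
    hom_ext_apply fun _ => rfl,
    .mk' (fun q => mappingPath.ext rfl fun t => ?_) (fun q => mappingPath.ext rfl fun t => ?_),
    path_hom_ext fun q s => mappingPath.ext rfl fun t => rfl⟩
  · have := mappingPath.pt_snd_zero q
    simpa using this
  · simp

/-- A morphism with a section `s` such that `s p` is homotopic to the identity over the base stays
a weak equivalence under cobase change along a dicofibration: the homotopy extends to the target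
of the dicofibration, and ends there at a map which factors through the pushout. -/
lemma dihomotopyEquivalences_cobaseChange_of_shrinkable {M Y X Z : UnderPo C} {p : M ⟶ Y}
    {i : M ⟶ X} {p' : X ⟶ Z} {i' : Y ⟶ Z} (sq : IsPushout i p p' i') (hi : dicofibrations C i)
    {s : Y ⟶ M} {D : M ⟶ pathObj M} (hs : s ≫ p = 𝟙 Y) (hD : IsHomotopy D (𝟙 M) (p ≫ s))
    (hDp : D ≫ pathMap p = p ≫ constPath Y) : dihomotopyEquivalences C p' := by
  have hD' := hD.postcomp i
  obtain ⟨H, H0, H1⟩ := hi.exists_extension (𝟙 X) (D ≫ pathMap i) (by simpa using hD'.zero)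
  obtain ⟨g, g0, g1⟩ := sq.exists_desc (H ≫ evalAt X 1) (s ≫ i) (by
    rw [reassoc_of% H0, ← Category.assoc, hD'.one, Category.assoc])
  obtain ⟨K, K0, K1⟩ := sq.exists_desc (H ≫ pathMap p') (i' ≫ constPath Z) (by
    have e : pathMap i ≫ pathMap p' = pathMap p ≫ pathMap i' := by
      change pathMap (i ≫ p') = pathMap (p ≫ i')
      rw [sq.w]
    rw [reassoc_of% H0, e, reassoc_of% hDp]
    rfl)
  refine dihomotopyEquivalences_of_homotopies g (h := K) (k := H)
    ⟨sq.hom_ext ?_ ?_, sq.hom_ext ?_ ?_⟩ ⟨H1, g0.symm⟩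
  · rw [reassoc_of% K0]
    change (H ≫ evalAt X 0) ≫ p' = _
    rw [H1, Category.id_comp, Category.comp_id]
  · rw [reassoc_of% K1]
    rfl
  · rw [reassoc_of% K0, reassoc_of% g0]
    rfl
  · rw [reassoc_of% K1, reassoc_of% g1, sq.w, reassoc_of% hs]
    rfl

instance : (dicofibrations C).IsStableUnderCobaseChange :=
  inferInstanceAs (MorphismProperty.llp _).IsStableUnderCobaseChange

instance : (dicofibrations C).IsMultiplicative :=
  inferInstanceAs (MorphismProperty.llp _).IsMultiplicative

/-- Weak equivalences are stable under cobase change along dicofibrations. -/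
lemma dihomotopyEquivalences_cobaseChange {A X Y Z : UnderPo C} {i : A ⟶ X} {f : A ⟶ Y}
    {f' : X ⟶ Z} {i' : Y ⟶ Z} (sq : IsPushout i f f' i') (hi : dicofibrations C i)
    (hf : dihomotopyEquivalences C f) : dihomotopyEquivalences C f' := by
  have hk := mappingPath.isStrongDeformationRetract_incl f
  have hq : dihomotopyEquivalences C (mappingPath.endpoint f) :=
    (dihomotopyEquivalences C).of_precomp _ _ hk.dihomotopyEquivalences
      ((mappingPath.incl_endpoint f).symm ▸ hf)
  obtain ⟨s, D, hs, hD, hDp⟩ :=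
    exists_section_of_trivial (mappingPath.difibrations_endpoint f) hq
  have sq₁ := pushoutObj_isPushout i (mappingPath.incl f)
  obtain ⟨d, d0, d1⟩ := sq₁.exists_desc f' (mappingPath.endpoint f ≫ i') (by
    rw [sq.w, ← Category.assoc, mappingPath.incl_endpoint])
  have sq₂ : IsPushout (pushoutInr i (mappingPath.incl f)) (mappingPath.endpoint f) d i' := by
    refine IsPushout.of_top (h₁₁ := i) (v₁₁ := mappingPath.incl f) ?_ d1 sq₁
    rwa [d0, mappingPath.incl_endpoint]
  rw [← d0]
  exact (dihomotopyEquivalences C).comp_mem _ _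
    (hk.cobaseChange sq₁.flip).dihomotopyEquivalences
    (dihomotopyEquivalences_cobaseChange_of_shrinkable sq₂
      (MorphismProperty.of_isPushout sq₁.flip hi) hs hD hDp)

/-! ### Cylinders and mapping cylinders -/

/-- The inclusion of both ends into the cylinder is a dicofibration, because homotopies lift along
trivial difibrations with both ends prescribed. -/
lemma dicofibrations_cylinder (X : UnderPo C) :
    dicofibrations C (coprod.desc (cylIn X 0) (cylIn X 1)) := by
  rintro E B p ⟨hp, hp'⟩
  refine ⟨fun {u v} sq => ?_⟩
  have w : IsHomotopy (curry v) ((coprod.inl ≫ u) ≫ p) ((coprod.inr ≫ u) ≫ p) :=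
    ⟨by rw [Category.assoc, sq.w, coprod.inl_desc_assoc, curry_evalAt],
      by rw [Category.assoc, sq.w, coprod.inr_desc_assoc, curry_evalAt]⟩
  obtain ⟨H, hH, hH'⟩ := exists_lift_of_trivial hp hp' w
  refine ⟨⟨⟨uncurry H, ?_, ?_⟩⟩⟩
  · ext1
    · rw [coprod.inl_desc_assoc, cylIn_uncurry, hH.zero]
    · rw [coprod.inr_desc_assoc, cylIn_uncurry, hH.one]
  · rw [← uncurry_curry v, ← hH', ← uncurry_curry (uncurry H ≫ p), curry_comp, curry_uncurry]

/-- The projection of the cylinder to its base. -/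
def cylProj (X : UnderPo C) : cyl X ⟶ X := uncurry (constPath X)

@[simp]
lemma cylIn_cylProj (X : UnderPo C) (t : I) : cylIn X t ≫ cylProj X = 𝟙 X := rfl

lemma dihomotopyEquivalences_cylProj (X : UnderPo C) :
    dihomotopyEquivalences C (cylProj X) := by
  have h : IsHomotopy (uncurry (curry (𝟙 (cyl X)) ≫ contractPath (cyl X)))
      (cylProj X ≫ cylIn X 0) (𝟙 (cyl X)) :=
    ⟨cyl_hom_ext fun x t => congr_arg (fun r : I => cylMk X (x, r)) (mul_zero t),
      cyl_hom_ext fun x t => congr_arg (fun r : I => cylMk X (x, r)) (mul_one t)⟩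
  exact ⟨cylIn X 0, dihomotopic_iff.2 ⟨_, .const (𝟙 X)⟩, dihomotopic_iff.2 ⟨_, h⟩⟩

/-- Every morphism factors through its mapping cylinder as a dicofibration followed by a weak
equivalence. -/
lemma exists_factorization {X Y : UnderPo C} (f : X ⟶ Y) :
    ∃ (Z : UnderPo C) (i : X ⟶ Z) (r : Z ⟶ Y),
      dicofibrations C i ∧ dihomotopyEquivalences C r ∧ i ≫ r = f := by
  have sq := pushoutObj_isPushout (cylIn X 0) f
  generalize pushoutObj (cylIn X 0) f = Z, pushoutInl (cylIn X 0) f = j,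
    pushoutInr (cylIn X 0) f = k at sq
  obtain ⟨r, hr, hr'⟩ := sq.exists_desc (cylProj X ≫ f) (𝟙 Y) (by
    rw [← Category.assoc, cylIn_cylProj, Category.id_comp, Category.comp_id])
  refine ⟨Z, cylIn X 1 ≫ j, r, ?_, ?_, by
    rw [Category.assoc, hr, ← Category.assoc, cylIn_cylProj, Category.id_comp]⟩
  · rintro E B p ⟨hp, hp'⟩
    obtain ⟨s, -, hs, -⟩ := exists_section_of_trivial hp hp'
    refine ⟨fun {u v} e => ?_⟩
    -- Lift on `Y` by the section of `p`, and then on the cylinder with both ends prescribed.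
    have w : IsHomotopy (curry (j ≫ v)) ((f ≫ k ≫ v ≫ s) ≫ p) (u ≫ p) :=
      ⟨by simp [hs, reassoc_of% sq.w], by simp [e.w]⟩
    obtain ⟨H, hH, hH'⟩ := exists_lift_of_trivial hp hp' w
    obtain ⟨l, l0, l1⟩ := sq.exists_desc (uncurry H) (k ≫ v ≫ s) (by simpa using hH.zero)
    refine ⟨⟨⟨l, ?_, sq.hom_ext ?_ ?_⟩⟩⟩
    · rw [Category.assoc, l0, cylIn_uncurry, hH.one]
    · rw [reassoc_of% l0, ← uncurry_curry (j ≫ v), ← hH', ← uncurry_curry (uncurry H ≫ p),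
        curry_comp, curry_uncurry]
    · rw [reassoc_of% l1, hs, Category.comp_id]
  · obtain ⟨K, K0, K1⟩ := sq.exists_desc (uncurry (curry j ≫ contractPath Z))
      (k ≫ constPath Z) (path_hom_ext fun x t => by
        have := congr_arg (fun g => g.right x) sq.w
        simpa using this)
    have hK : IsHomotopy K (r ≫ k) (𝟙 Z) := by
      refine ⟨sq.hom_ext ?_ ?_, sq.hom_ext ?_ ?_⟩
      · rw [reassoc_of% K0, reassoc_of% hr, ← sq.w]
        exact cyl_hom_ext fun x t => congr_arg (fun r : I => j.right (cylMk X (x, r))) (mul_zero t)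
      · rw [reassoc_of% K1, reassoc_of% hr']
        rfl
      · rw [reassoc_of% K0]
        exact cyl_hom_ext fun x t => congr_arg (fun r : I => j.right (cylMk X (x, r))) (mul_one t)
      · rw [reassoc_of% K1]
        rfl
    exact ⟨k, hr' ▸ dihomotopic_iff.2 ⟨_, .const _⟩, dihomotopic_iff.2 ⟨K, hK⟩⟩

/-! ### The cofibration category -/

lemma isCofibrationCategory :
    CofCat.IsCofibrationCategory (dihomotopyEquivalences C) (dicofibrations C) where
  hasInitial := inferInstance
  cof_of_isIso _ _ f _ := (dicofibrations C).of_isIso f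
  weq_of_isIso _ _ f _ := (dihomotopyEquivalences C).of_isIso f
  cof_comp _ _ _ f g hf hg := (dicofibrations C).comp_mem f g hf hg
  weq_comp _ _ _ f g hf hg := (dihomotopyEquivalences C).comp_mem f g hf hg
  weq_of_postcomp _ _ _ f g hg hfg := (dihomotopyEquivalences C).of_postcomp f g hg hfg
  weq_of_precomp _ _ _ f g hf hfg := (dihomotopyEquivalences C).of_precomp f g hf hfg
  hasPushout _ _ _ _ _ _ := inferInstance
  cof_cobaseChange _ _ _ _ _ _ _ _ sq hi := MorphismProperty.of_isPushout sq.flip hi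
  weq_cobaseChange _ _ _ _ _ _ _ _ sq hi hf := dihomotopyEquivalences_cobaseChange sq hi hf
  factorization _ _ f := exists_factorization f
  fibrantModel X := ⟨X, 𝟙 X, (dicofibrations C).id_mem X, (dihomotopyEquivalences C).id_mem X,
    fibrant X⟩

/-- Every object is cofibrant, because trivial difibrations have sections. -/
lemma emptyCofibrant (X : UnderPo C) : CofCat.EmptyCofibrant (dicofibrations C) X := by
  refine ⟨_, Under.mkIdInitial, ?_⟩
  rintro E B p ⟨hp, hp'⟩
  obtain ⟨s, -, hs, -⟩ := exists_section_of_trivial hp hp'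
  exact ⟨fun {u v} _ => ⟨⟨⟨v ≫ s, Under.mkIdInitial.hom_ext _ _, by simp [hs]⟩⟩⟩⟩

lemma homotopic_iff_dihomotopic {X Y : UnderPo C} (f g : X ⟶ Y) :
    CofCat.Homotopic (dihomotopyEquivalences C) (dicofibrations C) f g ↔ Dihomotopic f g := by
  constructor
  · rintro ⟨_, Z, i, r, H, -, hr, hir, hiH⟩
    -- Both inclusions of `X` into `Z` are inverse to `r` in the homotopy category.
    rw [dihomotopyEquivalences_eq] at hr
    have : IsIso ((toHo C).map r) := hr
    have e : (toHo C).map (coprod.inl ≫ i) = (toHo C).map (coprod.inr ≫ i) := by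
      rw [← cancel_mono ((toHo C).map r), ← Functor.map_comp, ← Functor.map_comp, Category.assoc,
        Category.assoc, hir, coprod.inl_desc, coprod.inr_desc]
    rw [← toHo_map_eq_iff, ← coprod.inl_desc f g, ← hiH, ← Category.assoc, Functor.map_comp, e,
      ← Functor.map_comp, Category.assoc, hiH, coprod.inr_desc]
  · intro h
    obtain ⟨h, hh⟩ := dihomotopic_iff.1 h
    refine ⟨inferInstance, cyl X, coprod.desc (cylIn X 0) (cylIn X 1), cylProj X, uncurry h,
      dicofibrations_cylinder X, dihomotopyEquivalences_cylProj X, ?_, ?_⟩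
    · rw [coprod.desc_comp, cylIn_cylProj, cylIn_cylProj]
    · rw [coprod.desc_comp, cylIn_uncurry, cylIn_uncurry, hh.zero, hh.one]

end UnderPo

theorem theorem6p1 (C : PoTop.{u}) :
    CofCat.IsCofibrationCategory (UnderPo.dihomotopyEquivalences C) (UnderPo.dicofibrations C) ∧
    (∀ X : UnderPo C,
      CofCat.Fibrant (UnderPo.dihomotopyEquivalences C) (UnderPo.dicofibrations C) X) ∧
    (∀ X : UnderPo C, CofCat.EmptyCofibrant (UnderPo.dicofibrations C) X) ∧
    ∀ (X Y : UnderPo C) (f g : X ⟶ Y),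
      CofCat.Homotopic (UnderPo.dihomotopyEquivalences C) (UnderPo.dicofibrations C) f g ↔
        UnderPo.Dihomotopic f g :=
  ⟨UnderPo.isCofibrationCategory, UnderPo.fibrant, UnderPo.emptyCofibrant,
    fun _ _ => UnderPo.homotopic_iff_dihomotopic⟩
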